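/- Fix a field $\mathbf k$ and integers $1\le r\le d$. All simplicial complexes are finite and contain the empty face; $f_{i-1}(\Delta)$ is the number of faces of $\Delta$ with $i$ vertices. A $(d-1)$-dimensional simplicial complex $\Delta$ is *balanced* if its vertices can be coloured with $d$ colours so that no face contains two vertices of the same colour. It is a *homology $(d-1)$-sphere* (over $\mathbf k$) if for every face $F\in\Delta$, including $F=\emptyset$, the link of $F$ has the reduced homology $\widetilde H_*(\mathbb S^{d-|F|-1};\mathbf k)$. For $0\le j\le d$ put $h_j(\Delta)=\sum_{i=0}^{j}(-1)^{j-i}\binom{d-i}{d-j}f_{i-1}(\Delta)$, and for $1\le j\le d$ put $\overline g_j(\Delta)=j\,h_j(\Delta)-(d-j+1)\,h_{j-1}(\Delta)$. A *cross-polytopal complex* of dimension $d$ is a finite $d$-dimensional regular CW complex $\mathcal X$ whose $(d-1)$-skeleton is a simplicial complex, in which the boundary of every $d$-cell is a copy of the boundary complex of the $d$-dimensional cross-polytope, and in which no two $d$-cells have the same vertex set. Its *boundary complex* $\partial\mathcal X$ consists of $\emptyset$ and of the faces $F$ with $H_*(\|\mathcal X\|,\|\mathcal X\|-p;\mathbf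 k)=0$ for $p$ in the relative interior of $F$. It is a *homology $d$-ball* if for every $p\in\|\mathcal X\|$ the relative homology $H_*(\|\mathcal X\|,\|\mathcal X\|-p;\mathbf k)$ is either zero or $\mathbf k$ concentrated in degree $d$, if $\widetilde H_*(\|\mathcal X\|;\mathbf k)=0$, and if $\partial\mathcal X$ is a homology $(d-1)$-sphere. A balanced homology $(d-1)$-sphere $\Delta$ has the *balanced $(r-1)$-stacked property* if there is a cross-polytopal complex $\mathcal X$ of dimension $d$ that is a homology $d$-ball with $\partial\mathcal X=\Delta$ and such that every face of $\mathcal X$ of dimension at most $d-r$ is a face of $\Delta$. **Theorem.** Let $\Delta$ be a balanced homology $(d-1)$-sphere with the balanced $(r-1)$-stacked property. Then $\overline g_j(\Delta)=0$ for all $r\le j\le\lfloor d/2\rfloor$. -/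

import Mathlib

/-- A finite (abstract) simplicial complex with vertices in `V`: a finite family of finite sets,
closed under taking subsets. The empty set counts as a face (of dimension `-1`) of every complex
that has a face at all; the vertices are the `v` for which `{v}` is a face. -/
@[ext]
structure FinSimplicialComplex (V : Type*) where
  /-- the faces, including the empty one -/
  faces : Finset (Finset V)
  down_closed : ∀ F ∈ faces, ∀ G, G ⊆ F → G ∈ faces

namespace FinSimplicialComplex

section Basic

variable {V W : Type*} [DecidableEq V] [DecidableEq W]

/-- The complex without any face, not even the empty one. -/
def void (V : Type*) : FinSimplicialComplex V where
  faces := ∅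
  down_closed := by simp

/-- `K.HasFaceSize n` says that `K` has dimension `n - 1`. -/
def HasFaceSize (K : FinSimplicialComplex V) (n : ℕ) : Prop :=
  (∃ F ∈ K.faces, F.card = n) ∧ ∀ F ∈ K.faces, F.card ≤ n

/-- The link of `F` in `K`. -/
def link (K : FinSimplicialComplex V) (F : Finset V) : FinSimplicialComplex V where
  faces := K.faces.filter fun G => Disjoint F G ∧ F ∪ G ∈ K.faces
  down_closed := by
    intro G hG H hH
    simp only [Finset.mem_filter] at hG ⊢
    exact ⟨K.down_closed G hG.1 H hH, hG.2.1.mono_right hH,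
      K.down_closed _ hG.2.2 _ (Finset.union_subset_union_right hH)⟩

/-- The subcomplex of the faces that do not contain `F`. For a nonempty face `F` of `K` and a point
`p` in its relative interior, its realization is a deformation retract of `‖K‖ - p`. -/
def deletion (K : FinSimplicialComplex V) (F : Finset V) : FinSimplicialComplex V where
  faces := K.faces.filter fun G => ¬ F ⊆ G
  down_closed := by
    intro G hG H hH
    simp only [Finset.mem_filter] at hG ⊢
    exact ⟨K.down_closed G hG.1 H hH, fun h => hG.2 (h.trans hH)⟩

/-- The isomorphic copy of `K` along an embedding of vertices. -/
def map (K : FinSimplicialComplex V) (f : V ↪ W) : FinSimplicialComplex W where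
  faces := K.faces.image (Finset.map f)
  down_closed := by
    intro F hF G hG
    obtain ⟨F', hF', rfl⟩ := Finset.mem_image.1 hF
    obtain ⟨G', hG', rfl⟩ := Finset.subset_map_iff.1 hG
    exact Finset.mem_image_of_mem _ (K.down_closed F' hF' G' hG')

/-- The union of two complexes. -/
def union (K L : FinSimplicialComplex V) : FinSimplicialComplex V where
  faces := K.faces ∪ L.faces
  down_closed := by
    intro F hF G hG
    rcases Finset.mem_union.1 hF with h | h
    · exact Finset.mem_union_left _ (K.down_closed F h G hG)
    · exact Finset.mem_union_right _ (L.down_closed F h G hG)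

/-- The union of a finite family of complexes. -/
def iUnion {n : ℕ} (K : Fin n → FinSimplicialComplex V) : FinSimplicialComplex V where
  faces := Finset.univ.biUnion fun i => (K i).faces
  down_closed := by
    intro F hF G hG
    obtain ⟨i, -, hi⟩ := Finset.mem_biUnion.1 hF
    exact Finset.mem_biUnion.2 ⟨i, Finset.mem_univ i, (K i).down_closed F hi G hG⟩

/-- The cone `b * K` over `K` with apex `b` (used when `b` is not a vertex of `K`). -/
def cone (b : V) (K : FinSimplicialComplex V) : FinSimplicialComplex V where
  faces := K.faces ∪ K.faces.image (insert b)
  down_closed := by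
    intro F hF G hG
    have key : ∃ F' ∈ K.faces, F ⊆ insert b F' := by
      rcases Finset.mem_union.1 hF with h | h
      · exact ⟨F, h, Finset.subset_insert b F⟩
      · obtain ⟨F', hF', rfl⟩ := Finset.mem_image.1 h
        exact ⟨F', hF', subset_rfl⟩
    obtain ⟨F', hF', hsub⟩ := key
    have hG' : G.erase b ∈ K.faces :=
      K.down_closed F' hF' _ (by grind)
    by_cases hb : b ∈ G
    · exact Finset.mem_union_right _
        (Finset.mem_image.2 ⟨G.erase b, hG', Finset.insert_erase hb⟩)
    · rw [Finset.erase_eq_of_notMem hb] at hG'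
      exact Finset.mem_union_left _ hG'

/-- The boundary complex of the `d`-dimensional cross-polytope: the vertices `(i, true)` and
`(i, false)` are antipodal, and a set is a face when it contains no antipodal pair. -/
def crossPolytope (d : ℕ) : FinSimplicialComplex (Fin d × Bool) where
  faces := Finset.univ.filter fun F => ∀ i, ¬ ((i, true) ∈ F ∧ (i, false) ∈ F)
  down_closed := by
    intro F hF G hG
    simp only [Finset.mem_filter, Finset.mem_univ, true_and] at hF ⊢
    exact fun i h => hF i ⟨hG h.1, hG h.2⟩

/-- A complex of dimension `d - 1` is balanced if its vertices can be coloured with `d` colours in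
such a way that no face contains two vertices of the same colour. -/
def IsBalanced (K : FinSimplicialComplex V) (d : ℕ) : Prop :=
  K.HasFaceSize d ∧ ∃ κ : V → Fin d, ∀ F ∈ K.faces, Set.InjOn κ (F : Set V)

/-- The number of faces with `i` vertices, that is `f_{i-1}`. -/
def numFaces (K : FinSimplicialComplex V) (i : ℕ) : ℕ :=
  (K.faces.filter fun F => F.card = i).card

/-- The `h`-number `h_j` (for `0 ≤ j ≤ d`) of a complex of dimension `d - 1`. -/
def hNumber (K : FinSimplicialComplex V) (d j : ℕ) : ℤ :=
  ∑ i ∈ Finset.range (j + 1), (-1) ^ (j - i) * ((d - i).choose (d - j) : ℤ) * (K.numFaces i : ℤ)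

/-- The balanced `g`-number `j h_j - (d - j + 1) h_{j-1}` (for `1 ≤ j ≤ d`) of a complex of
dimension `d - 1`. -/
def balancedG (K : FinSimplicialComplex V) (d j : ℕ) : ℤ :=
  (j : ℤ) * K.hNumber d j - ((d : ℤ) - (j : ℤ) + 1) * K.hNumber d (j - 1)

end Basic

noncomputable section Homology

variable (k : Type*) [Field k] {V : Type*} [LinearOrder V]

/-- The simplicial boundary operator: every simplex is oriented by the order on `V`, and the face
opposite to the vertex in position `i` (counting from `0`) gets the sign `(-1) ^ i`. On a vertex it
is the augmentation. -/
def boundaryMap : (Finset V →₀ k) →ₗ[k] (Finset V →₀ k) :=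
  Finsupp.linearCombination k fun F : Finset V =>
    ∑ v ∈ F, Finsupp.single (F.erase v) ((-1 : k) ^ (F.filter fun w => w < v).card)

/-- The (augmented) simplicial chains in degree `n - 1`, spanned by the faces with `n` vertices. -/
def chains (K : FinSimplicialComplex V) (n : ℕ) : Submodule k (Finset V →₀ k) :=
  Finsupp.supported k k {F | F ∈ K.faces ∧ F.card = n}

/-- The relative cycles of `(K, L)` in degree `n - 1`: chains of `K` with boundary in `L`. -/
def relCycles (K L : FinSimplicialComplex V) (n : ℕ) : Submodule k (Finset V →₀ k) :=
  chains k K n ⊓ (Finsupp.supported k k {F | F ∈ L.faces}).comap (boundaryMap k)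

/-- The relative boundaries of `(K, L)` in degree `n - 1`: boundaries in `K` plus chains of `L`. -/
def relBoundaries (K L : FinSimplicialComplex V) (n : ℕ) : Submodule k (Finset V →₀ k) :=
  (chains k K (n + 1)).map (boundaryMap k) ⊔ chains k L n

/-- The dimension of the quotient `Z / B` of a space of cycles by a space of boundaries `B ≤ Z`. -/
def quotientDim {M : Type*} [AddCommGroup M] [Module k M] (Z B : Submodule k M) : ℕ :=
  Module.finrank k (Z ⧸ B.submoduleOf Z)

/-- The dimension of the relative simplicial homology `H_{n-1}(K, L; k)` of a complex `K` and a
subcomplex `L`. -/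
def relBetti (K L : FinSimplicialComplex V) (n : ℕ) : ℕ :=
  quotientDim k (relCycles k K L n) (relBoundaries k K L n)

/-- The reduced Betti number in degree `n - 1`, the dimension of the reduced simplicial homology
`H̃_{n-1}(K; k)`. -/
def reducedBetti (K : FinSimplicialComplex V) (n : ℕ) : ℕ :=
  relBetti k K (void V) n

/-- The dimension of `H_{n-1}(‖K‖, ‖K‖ - p; k)` for a point `p` in the relative interior of the
nonempty face `F`. -/
def localBetti (K : FinSimplicialComplex V) (F : Finset V) (n : ℕ) : ℕ :=
  relBetti k K (K.deletion F) n

/-- The link of `F` has the reduced homology of a sphere of dimension `d - |F| - 1`: it is `k` in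
that degree and zero in all others. -/
def LinkIsSphereLike (K : FinSimplicialComplex V) (d : ℕ) (F : Finset V) : Prop :=
  ∀ n, reducedBetti k (K.link F) n = if n + F.card = d then 1 else 0

/-- `K` is a homology sphere over `k` of dimension `d - 1`. -/
def IsHomologySphere (K : FinSimplicialComplex V) (d : ℕ) : Prop :=
  K.HasFaceSize d ∧ ∀ F ∈ K.faces, LinkIsSphereLike k K d F

/-- `K` is a closed homology manifold over `k` of dimension `d - 1`. -/
def IsClosedHomologyManifold (K : FinSimplicialComplex V) (d : ℕ) : Prop :=
  K.HasFaceSize d ∧ ∀ F ∈ K.faces, F.Nonempty → LinkIsSphereLike k K d F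

/-- The local homology at the interior points of `F` is that at an interior point of a `d`-ball:
`k` in degree `d` and zero in all others. -/
def LocallySphere (K : FinSimplicialComplex V) (d : ℕ) (F : Finset V) : Prop :=
  ∀ n, localBetti k K F n = if n = d + 1 then 1 else 0

/-- The local homology at the interior points of `F` vanishes, as at a boundary point of a ball. -/
def LocallyAcyclic (K : FinSimplicialComplex V) (F : Finset V) : Prop :=
  ∀ n, localBetti k K F n = 0

/-- `B` is the boundary complex of `K`: it consists of the empty face and of the faces at whose
interior points the local homology vanishes. -/
def IsBoundaryComplex (K B : FinSimplicialComplex V) : Prop :=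
  ∀ F, F ∈ B.faces ↔ F = ∅ ∨ (F ∈ K.faces ∧ LocallyAcyclic k K F)

/-- `K` is a homology manifold over `k` of dimension `d` with boundary complex `B`. -/
structure IsHomologyManifoldWithBoundary (K B : FinSimplicialComplex V) (d : ℕ) : Prop where
  dim_eq : K.HasFaceSize (d + 1)
  locally_ball : ∀ F ∈ K.faces, F.Nonempty → LocallyAcyclic k K F ∨ LocallySphere k K d F
  isBoundary : IsBoundaryComplex k K B
  boundary_manifold : IsClosedHomologyManifold k B d

/-- `K` is a homology ball over `k` of dimension `d` with boundary complex `B`. -/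
structure IsHomologyBall (K B : FinSimplicialComplex V) (d : ℕ) : Prop where
  isManifold : IsHomologyManifoldWithBoundary k K B d
  acyclic : ∀ n, reducedBetti k K n = 0
  boundary_sphere : IsHomologySphere k B d

end Homology

end FinSimplicialComplex

/-- A cross-polytopal complex of dimension `d`, given by the combinatorial data that determine it: a
simplicial complex as its `(d-1)`-skeleton, and finitely many `d`-cells (at least one), each attached
to a copy of the boundary of the `d`-dimensional cross-polytope in the skeleton, no two of them with
the same vertex set. -/
structure CrossPolytopalComplex (V : Type*) [DecidableEq V] (d : ℕ) where
  skeleton : FinSimplicialComplex V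
  skeleton_card_le : ∀ F ∈ skeleton.faces, F.card ≤ d
  numCells : ℕ
  numCells_pos : 0 < numCells
  /-- the vertices of the cells; `cell i (j, true)` and `cell i (j, false)` are antipodal -/
  cell : Fin numCells → (Fin d × Bool ↪ V)
  cell_boundary : ∀ i, ((FinSimplicialComplex.crossPolytope d).map (cell i)).faces ⊆ skeleton.faces
  cell_vertices_injective : Function.Injective fun i => Finset.univ.map (cell i)

namespace CrossPolytopalComplex

variable {V : Type*}

/-- The inclusion of the vertices in those of the stellar subdivision. -/
def oldVertex (V : Type*) (m : ℕ) : V ↪ V ⊕ₗ Fin m :=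
  Function.Embedding.inl.trans toLex.toEmbedding

/-- The triangulation of a cross-polytopal complex by stellar subdivision of its `d`-cells: every
`d`-cell is replaced by the cone over its boundary whose apex is a new vertex. It has the same
underlying space. -/
def stellar [LinearOrder V] {d : ℕ} (X : CrossPolytopalComplex V d) :
    FinSimplicialComplex (V ⊕ₗ Fin X.numCells) :=
  (X.skeleton.map (oldVertex V X.numCells)).union
    (FinSimplicialComplex.iUnion fun i =>
      FinSimplicialComplex.cone (toLex (Sum.inr i))
        ((FinSimplicialComplex.crossPolytope d).map ((X.cell i).trans (oldVertex V X.numCells))))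

/-- The cross-polytopal complex `X` is a homology `d`-ball over `k` with boundary complex `Δ`. Local
homology, homology and boundary are those of the triangulation `X.stellar` of its underlying
space. -/
def IsHomologyBall (k : Type*) [Field k] [LinearOrder V] {d : ℕ} (X : CrossPolytopalComplex V d)
    (Δ : FinSimplicialComplex V) : Prop :=
  FinSimplicialComplex.IsHomologyBall k X.stellar (Δ.map (oldVertex V X.numCells)) d

end CrossPolytopalComplex

/-- The balanced `(r-1)`-stacked property, for `1 ≤ r ≤ d`, of a balanced homology sphere `Δ` of
dimension `d - 1`: some cross-polytopal complex `X` is a homology `d`-ball with boundary complex `Δ`,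
and all faces of `X` of dimension at most `d - r` are faces of `Δ`. -/
def FinSimplicialComplex.HasBalancedStackedProperty (k : Type*) [Field k] {V : Type*}
    [LinearOrder V] (Δ : FinSimplicialComplex V) (d r : ℕ) : Prop :=
  ∃ X : CrossPolytopalComplex V d, X.IsHomologyBall k Δ ∧
    ∀ F ∈ X.skeleton.faces, F.card + r ≤ d + 1 → F ∈ Δ.faces

/-! Let `m` be the number of `d`-cells of the ball `X`. The proof shows `h_j(Δ) = m * d.choose j`
for `r - 1 ≤ j ≤ d + 1 - r`; the vanishing of `balancedG` is then the identity `j * d.choose j = (d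
- j + 1) * d.choose (j - 1)`.

The edges of `X` lie in `Δ`, so a proper colouring `κ` of `Δ` also colours the skeleton of `X`
properly. The number `h_j` is the sum of the flag `h`-numbers over colour sets `R` of size `j`
(`hNumber_eq_sum_colours`), and each of these turns out to be `m`. To see this, note that a face of
`X` coloured outside `R` has at most `d - j` vertices, hence lies in `Δ`. Vanishing local homology,
or acyclicity of `X` for the empty face, makes the alternating sum over its superfaces in
`X.stellar` zero. By inclusion-exclusion (`sum_faces_avoiding_eq_zero`) the alternating sum over the
faces of `X.stellar` without old vertices coloured outside `R` is zero too. Each cell contributes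
`-(-1) ^ #R` through its apex (`sum_coneFaces`), so the `R`-coloured faces of the skeleton
contribute `m * (-1) ^ #R`. These have at most `j` vertices, hence are exactly the `R`-coloured
faces of `Δ`.

Homology enters only through Euler characteristics. -/

namespace FinSimplicialComplex
open Finset

/-! ### Chain spaces and face counts. -/

section Chains
variable {k : Type*} [Field k] {V : Type*}

theorem chains_mono {K L : FinSimplicialComplex V} (h : L.faces ⊆ K.faces) (n : ℕ) :
    chains k L n ≤ chains k K n :=
  Finsupp.supported_mono fun _ hF => ⟨h hF.1, hF.2⟩

theorem finite_chains (K : FinSimplicialComplex V) (n : ℕ) : Module.Finite k (chains k K n) :=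
  have : Finite {F | F ∈ K.faces ∧ F.card = n} :=
    (K.faces.finite_toSet.subset fun _ h => h.1).to_subtype
  Module.Finite.equiv (Finsupp.supportedEquivFinsupp (M := k) (R := k) _).symm

theorem finrank_chains (K : FinSimplicialComplex V) (n : ℕ) :
    Module.finrank k (chains k K n) = K.numFaces n := by
  have e : {F | F ∈ K.faces ∧ F.card = n} = ((K.faces.filter fun F => F.card = n : Finset _) : Set _) := by
    ext; simp
  rw [chains, e, (Finsupp.supportedEquivFinsupp (M := k) (R := k) _).finrank_eq,
    Module.finrank_finsupp_self]
  simp [numFaces]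

theorem chains_inf_supported {K L : FinSimplicialComplex V} (h : L.faces ⊆ K.faces) (n : ℕ) :
    chains k K n ⊓ Finsupp.supported k k {F | F ∈ L.faces} = chains k L n := by
  rw [chains, chains, ← Finsupp.supported_inter]
  congr 1
  ext F
  exact ⟨fun hF => ⟨hF.2, hF.1.2⟩, fun hF => ⟨⟨h hF.1, hF.2⟩, hF.1⟩⟩

theorem sum_faces_eq_sum_numFaces (K : FinSimplicialComplex V) {N : ℕ}
    (hN : ∀ F ∈ K.faces, #F < N) :
    ∑ F ∈ K.faces, (-1 : ℤ) ^ #F = ∑ n ∈ range N, (-1 : ℤ) ^ n * K.numFaces n := by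
  rw [← sum_fiberwise_of_maps_to (t := range N) (g := Finset.card) (by simpa using hN)]
  refine sum_congr rfl fun n _ => ?_
  rw [sum_congr rfl (g := fun _ => (-1 : ℤ) ^ n) (fun F hF => by rw [(mem_filter.1 hF).2])]
  simp [numFaces, mul_comm]

end Chains

/-! ### Euler characteristics of pairs with vanishing relative homology. -/

section Homology
variable {k : Type*} [Field k] {V : Type*} [LinearOrder V]

theorem boundaryMap_single (F : Finset V) (a : k) :
    boundaryMap k (Finsupp.single F a) =
      a • ∑ v ∈ F, Finsupp.single (F.erase v) ((-1 : k) ^ (F.filter fun w => w < v).card) := by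
  simp [boundaryMap, Finsupp.linearCombination_single]

/-- Removing the larger vertex `w` keeps the position of `v`, while removing `v` lowers that of `w`
by one; hence the two signs are opposite. -/
theorem sign_erase_swap {F : Finset V} {v w : V} (hv : v ∈ F) (hvw : v < w) :
    (-1 : k) ^ #{u ∈ F | u < v} * (-1 : k) ^ #{u ∈ F.erase v | u < w} +
      (-1 : k) ^ #{u ∈ F | u < w} * (-1 : k) ^ #{u ∈ F.erase w | u < v} = 0 := by
  have h1 : {u ∈ F.erase w | u < v} = {u ∈ F | u < v} := by
    ext u; simp only [mem_filter, mem_erase]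
    exact ⟨fun h => ⟨h.1.2, h.2⟩, fun h => ⟨⟨(h.2.trans hvw).ne, h.1⟩, h.2⟩⟩
  have h2 : #{u ∈ F | u < w} = #{u ∈ F.erase v | u < w} + 1 := by
    rw [filter_erase, card_erase_add_one]
    simp [hv, hvw]
  rw [h1, h2]
  ring

theorem boundaryMap_boundaryMap (x : Finset V →₀ k) : boundaryMap k (boundaryMap k x) = 0 := by
  induction x using Finsupp.induction_linear with
  | zero => simp
  | add f g hf hg => simp [hf, hg]
  | single F a =>
    rw [boundaryMap_single, map_smul, map_sum]
    simp_rw [boundaryMap_single]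
    convert smul_zero a
    simp_rw [smul_sum, Finsupp.smul_single, smul_eq_mul]
    rw [Finset.sum_sigma']
    refine Finset.sum_involution (fun p _ => ⟨p.2, p.1⟩) ?_ ?_ ?_ ?_
    · rintro ⟨v, w⟩ h
      simp only [mem_sigma, mem_erase] at h
      obtain ⟨hv, hne, hw⟩ := h
      dsimp only
      rw [erase_right_comm, ← Finsupp.single_add]
      rcases lt_or_gt_of_ne hne with h | h
      · rw [add_comm, sign_erase_swap hw h, Finsupp.single_zero]
      · rw [sign_erase_swap hv h, Finsupp.single_zero]
    · rintro ⟨v, w⟩ h _ he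
      simp only [mem_sigma, mem_erase] at h
      simp only [Sigma.mk.injEq] at he
      exact h.2.1 he.1
    · rintro ⟨v, w⟩ h
      simp only [mem_sigma, mem_erase] at h ⊢
      exact ⟨h.2.2, Ne.symm h.2.1, h.1⟩
    · rintro ⟨v, w⟩ h
      rfl

theorem boundaryMap_mem_chains {K : FinSimplicialComplex V} {n : ℕ} {x : Finset V →₀ k}
    (hx : x ∈ chains k K (n + 1)) : boundaryMap k x ∈ chains k K n := by
  rw [boundaryMap, Finsupp.linearCombination_apply]
  refine Submodule.sum_mem _ fun F hF => Submodule.smul_mem _ _ <|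
    Submodule.sum_mem _ fun v hv => Finsupp.single_mem_supported _ _ ?_
  have hF' := (Finsupp.mem_supported _ _).1 hx hF
  exact ⟨K.down_closed F hF'.1 _ (erase_subset _ _), by rw [card_erase_of_mem hv, hF'.2]; rfl⟩

theorem boundaryMap_eq_zero_of_mem_chains_zero {K : FinSimplicialComplex V} {x : Finset V →₀ k}
    (hx : x ∈ chains k K 0) : boundaryMap k x = 0 := by
  rw [boundaryMap, Finsupp.linearCombination_apply]
  refine Finset.sum_eq_zero fun F hF => ?_
  have hF' := (Finsupp.mem_supported _ _).1 hx hF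
  rw [Finset.card_eq_zero.1 hF'.2]
  simp

theorem finrank_map_add_finrank_inf_ker {M N : Type*} [AddCommGroup M] [Module k M]
    [AddCommGroup N] [Module k N] (f : M →ₗ[k] N) (p : Submodule k M) [Module.Finite k p] :
    Module.finrank k (p.map f) + Module.finrank k (p ⊓ LinearMap.ker f : Submodule k M) =
      Module.finrank k p := by
  rw [← LinearMap.finrank_range_add_finrank_ker (f.domRestrict p), LinearMap.range_domRestrict]
  congr 1
  rw [LinearMap.ker_domRestrict, ← Submodule.finrank_map_subtype_eq, Submodule.map_comap_subtype]

theorem relBoundaries_le_relCycles {K L : FinSimplicialComplex V} (h : L.faces ⊆ K.faces) (n : ℕ) :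
    relBoundaries k K L n ≤ relCycles k K L n := by
  refine sup_le ?_ ?_
  · rintro _ ⟨x, hx, rfl⟩
    exact ⟨boundaryMap_mem_chains hx, by
      simp [boundaryMap_boundaryMap]⟩
  · intro x hx
    refine ⟨chains_mono h n hx, ?_⟩
    cases n with
    | zero => simp [boundaryMap_eq_zero_of_mem_chains_zero hx]
    | succ n =>
      exact Finsupp.supported_mono (fun _ hF => hF.1) (boundaryMap_mem_chains hx)

theorem finite_relCycles (K L : FinSimplicialComplex V) (n : ℕ) :
    Module.Finite k (relCycles k K L n) :=
  have := finite_chains (k := k) K n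
  Submodule.finiteDimensional_of_le (inf_le_left : relCycles k K L n ≤ chains k K n)

theorem relCycles_eq_relBoundaries {K L : FinSimplicialComplex V} (h : L.faces ⊆ K.faces) {n : ℕ}
    (hz : relBetti k K L n = 0) : relCycles k K L n = relBoundaries k K L n := by
  have := finite_relCycles (k := k) K L n
  refine le_antisymm ?_ (relBoundaries_le_relCycles h n)
  have hs := Module.finrank_zero_iff.1 hz
  exact Submodule.submoduleOf_eq_top.1 (Submodule.Quotient.subsingleton_iff.1 hs)

/-- When the relative homology vanishes, the relative chains in degree `n` split into the relative
cycles in degrees `n` and `n - 1`. -/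
theorem numFaces_succ_add_numFaces {K L : FinSimplicialComplex V} (h : L.faces ⊆ K.faces) {n : ℕ}
    (hz : relBetti k K L n = 0) :
    K.numFaces (n + 1) + L.numFaces n =
      Module.finrank k (relCycles k K L (n + 1)) + Module.finrank k (relCycles k K L n) := by
  have := finite_relCycles (k := k) K L n
  have := finite_chains (k := k) K (n + 1)
  set S := Finsupp.supported k k {F | F ∈ L.faces} with hS
  have h1 := finrank_map_add_finrank_inf_ker (S.mkQ ∘ₗ boundaryMap k) (chains k K (n + 1))
  have h2 := finrank_map_add_finrank_inf_ker S.mkQ (relCycles k K L n)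
  have e1 : chains k K (n + 1) ⊓ LinearMap.ker (S.mkQ ∘ₗ boundaryMap k) =
      relCycles k K L (n + 1) := by
    rw [LinearMap.ker_comp, Submodule.ker_mkQ]; rfl
  have e2 : relCycles k K L n ⊓ LinearMap.ker S.mkQ = chains k L n := by
    rw [Submodule.ker_mkQ]
    refine le_antisymm ?_ (le_inf ?_ ?_)
    · rw [← chains_inf_supported h n]
      exact inf_le_inf_right _ inf_le_left
    · exact le_sup_right.trans (relBoundaries_le_relCycles h n)
    · exact Finsupp.supported_mono fun _ hF => hF.1
  -- Vanishing homology enters here: modulo chains of `L`, every relative cycle is a boundary.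
  have e3 : (relCycles k K L n).map S.mkQ =
      (chains k K (n + 1)).map (S.mkQ ∘ₗ boundaryMap k) := by
    rw [relCycles_eq_relBoundaries h hz, relBoundaries, Submodule.map_sup, Submodule.map_comp,
      sup_eq_left]
    have : (chains k L n).map S.mkQ = ⊥ := by
      rw [← LinearMap.le_ker_iff_map, Submodule.ker_mkQ]
      exact Finsupp.supported_mono fun _ hF => hF.1
    rw [this]
    exact bot_le
  rw [e1, finrank_chains] at h1
  rw [e2, e3, finrank_chains] at h2
  omega

/-- The rank identity of `numFaces_succ_add_numFaces` telescopes, leaving the rank of the relative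
cycles modulo chains of `L` in the last degree. -/
theorem sum_numFaces_sub_eq {K L : FinSimplicialComplex V} (h : L.faces ⊆ K.faces)
    (hz : ∀ n, relBetti k K L n = 0) (N : ℕ) :
    ∑ n ∈ range (N + 1), (-1 : ℤ) ^ n * (K.numFaces n - L.numFaces n) =
      (-1) ^ N * (Module.finrank k (relCycles k K L N) - L.numFaces N) := by
  induction N with
  | zero =>
    have : relCycles k K L 0 = chains k K 0 := by
      refine inf_eq_left.2 fun x hx => ?_
      simp [boundaryMap_eq_zero_of_mem_chains_zero hx]
    rw [this, finrank_chains]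
    simp
  | succ N ih =>
    rw [sum_range_succ, ih]
    have := numFaces_succ_add_numFaces h (hz N)
    zify at this
    rw [pow_succ]
    linear_combination -(-1 : ℤ) ^ N * this

/-- The Euler characteristic of a pair with vanishing relative homology is zero. -/
theorem sum_faces_eq_of_relBetti_eq_zero {K L : FinSimplicialComplex V} (h : L.faces ⊆ K.faces)
    (hz : ∀ n, relBetti k K L n = 0) :
    ∑ F ∈ K.faces, (-1 : ℤ) ^ #F = ∑ F ∈ L.faces, (-1 : ℤ) ^ #F := by
  -- One more than the largest face size, so that the remainder term of the truncated sum vanishes.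
  set N := K.faces.sup Finset.card + 1 with hNdef
  have hN : ∀ F ∈ K.faces, #F < N := fun F hF => Nat.lt_succ_of_le (le_sup hF)
  have hK0 : K.numFaces N = 0 := by
    rw [numFaces, Finset.card_eq_zero, filter_eq_empty_iff]
    exact fun F hF => (hN F hF).ne
  have hL0 : L.numFaces N = 0 := by
    rw [numFaces, Finset.card_eq_zero, filter_eq_empty_iff]
    exact fun F hF => (hN F (h hF)).ne
  have hZ : Module.finrank k (relCycles k K L N) = 0 := by
    have := finite_chains (k := k) K N
    have := Submodule.finrank_mono (inf_le_left : relCycles k K L N ≤ chains k K N)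
    rw [finrank_chains, hK0] at this
    exact Nat.le_zero.1 this
  have := sum_numFaces_sub_eq h hz N
  rw [sum_range_succ, hK0, hL0, hZ] at this
  rw [sum_faces_eq_sum_numFaces K hN, sum_faces_eq_sum_numFaces L fun F hF => hN F (h hF),
    ← sub_eq_zero, ← sum_sub_distrib]
  simpa [mul_sub] using this

theorem sum_superfaces_eq_zero_of_locallyAcyclic {K : FinSimplicialComplex V} {F : Finset V}
    (hF : LocallyAcyclic k K F) : ∑ G ∈ K.faces with F ⊆ G, (-1 : ℤ) ^ #G = 0 := by
  have h := sum_faces_eq_of_relBetti_eq_zero (filter_subset _ _) hF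
  rw [← sum_filter_add_sum_filter_not K.faces (fun G => F ⊆ G)] at h
  simpa [deletion] using h

theorem sum_faces_eq_zero_of_acyclic {K : FinSimplicialComplex V}
    (hK : ∀ n, reducedBetti k K n = 0) : ∑ G ∈ K.faces, (-1 : ℤ) ^ #G = 0 := by
  have h := sum_faces_eq_of_relBetti_eq_zero (empty_subset _) hK
  simpa [void] using h

end Homology

/-! ### Alternating sums over faces and flag `h`-numbers. -/

section Combinatorics
variable {V : Type*} [DecidableEq V]

/-- If the alternating sums over the superfaces of all faces inside `p` vanish, then so does the
alternating sum over the faces that avoid `p`. -/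
theorem sum_faces_avoiding_eq_zero (K : FinSimplicialComplex V) (p : V → Prop) [DecidablePred p]
    (h : ∀ F ∈ K.faces, (∀ v ∈ F, p v) → ∑ G ∈ K.faces with F ⊆ G, (-1 : ℤ) ^ #G = 0) :
    ∑ G ∈ K.faces with ∀ v ∈ G, ¬ p v, (-1 : ℤ) ^ #G = 0 := by
  have h0 : ∑ F ∈ K.faces with ∀ v ∈ F, p v,
      (-1 : ℤ) ^ #F * ∑ G ∈ K.faces with F ⊆ G, (-1 : ℤ) ^ #G = 0 :=
    sum_eq_zero fun F hF => by
      rw [h F (mem_filter.1 hF).1 (mem_filter.1 hF).2, mul_zero]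
  rw [← h0]
  simp_rw [mul_sum]
  -- For fixed `G` the inner sum runs over all subsets of `G.filter p`, so it vanishes unless `G`
  -- avoids `p`.
  rw [sum_comm' (t' := K.faces) (s' := fun G => (G.filter p).powerset)]
  · rw [sum_filter]
    refine sum_congr rfl fun G _ => ?_
    rw [← sum_mul, sum_powerset_neg_one_pow_card]
    simp only [filter_eq_empty_iff]
    split_ifs <;> simp
  · intro F G
    simp only [mem_filter, mem_powerset]
    refine ⟨fun ⟨⟨_, h1⟩, h2, h3⟩ => ⟨fun v hv => mem_filter.2 ⟨h3 hv, h1 v hv⟩, h2⟩,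
      fun ⟨h1, h2⟩ => ?_⟩
    have h3 : F ⊆ G := h1.trans (filter_subset _ _)
    exact ⟨⟨K.down_closed G h2 F h3, fun v hv => (mem_filter.1 (h1 hv)).2⟩, h2, h3⟩

/-- A face independently chooses neither or one end of each diagonal in `R`, so each such diagonal
gives a factor `1 - 1 - 1 = -1`. -/
theorem sum_crossPolytope_faces (d : ℕ) (R : Finset (Fin d)) :
    ∑ H ∈ (crossPolytope d).faces with ∀ x ∈ H, x.1 ∈ R, (-1 : ℤ) ^ #H = (-1) ^ #R := by
  have hprod := Finset.prod_univ_sum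
    (fun i : Fin d => if i ∈ R then ({∅, {true}, {false}} : Finset (Finset Bool)) else {∅})
    (fun _ s => (-1 : ℤ) ^ #s)
  have hR : ∏ i : Fin d, ∑ s ∈ (if i ∈ R then ({∅, {true}, {false}} : Finset (Finset Bool))
      else {∅}), (-1 : ℤ) ^ #s = (-1) ^ #R := by
    have : ∀ i : Fin d, ∑ s ∈ (if i ∈ R then ({∅, {true}, {false}} : Finset (Finset Bool))
      else {∅}), (-1 : ℤ) ^ #s = if i ∈ R then -1 else 1 := by
      intro i; split_ifs <;> rfl
    simp_rw [this]
    rw [prod_ite]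
    simp
  rw [← hR, hprod]
  symm
  refine sum_nbij' (fun g => (univ : Finset (Fin d × Bool)).filter fun x => x.2 ∈ g x.1)
    (fun H i => univ.filter fun b => (i, b) ∈ H) ?_ ?_ ?_ ?_ ?_
  · intro g hg
    rw [Fintype.mem_piFinset] at hg
    simp only [crossPolytope, mem_filter, mem_univ, true_and, Prod.forall]
    refine ⟨fun i hi => ?_, fun i b hb => ?_⟩
    · have := hg i
      split_ifs at this
      · simp only [mem_insert, mem_singleton] at this
        rcases this with h | h | h <;> simp [h] at hi
      · simp only [mem_singleton] at this
        simp [this] at hi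
    · by_contra hi
      have := hg i
      simp only [hi, if_false, mem_singleton] at this
      simp [this] at hb
  · intro H hH
    simp only [crossPolytope, mem_filter, mem_univ, true_and, Prod.forall] at hH
    rw [Fintype.mem_piFinset]
    intro i
    have h1 := hH.1 i
    have h2 := hH.2 i
    by_cases ht : (i, true) ∈ H <;> by_cases hf : (i, false) ∈ H
    · exact absurd ⟨ht, hf⟩ h1
    · have e : (univ.filter fun b => (i, b) ∈ H) = {true} := by ext b; cases b <;> simp [ht, hf]
      rw [e, if_pos (h2 _ ht)]; simp
    · have e : (univ.filter fun b => (i, b) ∈ H) = {false} := by ext b; cases b <;> simp [ht, hf]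
      rw [e, if_pos (h2 _ hf)]; simp
    · have e : (univ.filter fun b => (i, b) ∈ H) = ∅ := by ext b; cases b <;> simp [ht, hf]
      rw [e]; split_ifs <;> simp
  · intro g _
    ext i b; simp
  · intro H _
    ext ⟨i, b⟩; simp
  · intro g _
    rw [prod_pow_eq_pow_sum]
    congr 1
    rw [← card_sigma]
    refine card_bij (fun x _ => (x.1, x.2)) ?_ ?_ ?_
    · rintro ⟨i, b⟩ h; simpa using h
    · rintro ⟨i, b⟩ _ ⟨i', b'⟩ _ h; simpa using h
    · rintro ⟨i, b⟩ h; exact ⟨⟨i, b⟩, by simpa using h, rfl⟩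

end Combinatorics

/-- The `h`-numbers of a properly coloured complex are sums of flag `h`-numbers. -/
theorem hNumber_eq_sum_colours {V : Type*} (K : FinSimplicialComplex V) {d j : ℕ} (hj : j ≤ d) (κ : V → Fin d)
    (hκ : ∀ F ∈ K.faces, Set.InjOn κ (F : Set V)) :
    K.hNumber d j = ∑ R ∈ powersetCard j (univ : Finset (Fin d)),
      ∑ F ∈ K.faces with ∀ v ∈ F, κ v ∈ R, (-1 : ℤ) ^ (j - #F) := by
  -- A colour set of size `j` containing the `#F` colours of `F` is fixed by its other `j - #F`
  -- colours.
  have hcount : ∀ F ∈ K.faces, #{R ∈ powersetCard j (univ : Finset (Fin d)) | F.image κ ⊆ R} =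
      if #F ≤ j then (d - #F).choose (d - j) else 0 := by
    intro F hF
    have hc : #(F.image κ) = #F := card_image_of_injOn (hκ F hF)
    split_ifs with hle
    · have hd : #F ≤ d := hle.trans hj
      have : {R ∈ powersetCard j (univ : Finset (Fin d)) | F.image κ ⊆ R} =
          (powersetCard (j - #F) (univ \ F.image κ)).image (fun Q => Q ∪ F.image κ) := by
        ext R
        simp only [mem_filter, mem_powersetCard, subset_univ, true_and, mem_image]
        constructor
        · rintro ⟨h1, h2⟩
          refine ⟨R \ F.image κ, ⟨sdiff_subset_sdiff (subset_univ _) subset_rfl, ?_⟩,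
            sdiff_union_of_subset h2⟩
          rw [card_sdiff_of_subset h2, h1, hc]
        · rintro ⟨Q, ⟨h1, h2⟩, rfl⟩
          refine ⟨?_, subset_union_right⟩
          rw [card_union_of_disjoint (disjoint_of_subset_left h1 sdiff_disjoint), h2, hc]
          omega
      rw [this, card_image_of_injOn, card_powersetCard, card_sdiff_of_subset (subset_univ _), hc,
        card_univ, Fintype.card_fin]
      · rw [← Nat.choose_symm (by omega)]
        congr 1; omega
      · intro Q hQ Q' hQ' h
        simp only [mem_coe, mem_powersetCard] at hQ hQ'
        have e1 := union_sdiff_cancel_right (disjoint_of_subset_left hQ.1 sdiff_disjoint)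
        have e2 := union_sdiff_cancel_right (disjoint_of_subset_left hQ'.1 sdiff_disjoint)
        rw [← e1, ← e2]
        exact congrArg (· \ F.image κ) h
    · rw [Finset.card_eq_zero, filter_eq_empty_iff]
      intro R hR hs
      have := card_le_card hs
      rw [hc, (mem_powersetCard.1 hR).2] at this
      exact hle this
  have hR : ∑ R ∈ powersetCard j (univ : Finset (Fin d)),
      ∑ F ∈ K.faces with ∀ v ∈ F, κ v ∈ R, (-1 : ℤ) ^ (j - #F) =
      ∑ F ∈ K.faces, if #F ≤ j then (-1 : ℤ) ^ (j - #F) * ((d - #F).choose (d - j) : ℤ) else 0 := by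
    rw [sum_comm' (t' := K.faces) (s' := fun F =>
      {R ∈ powersetCard j (univ : Finset (Fin d)) | F.image κ ⊆ R})]
    · refine sum_congr rfl fun F hF => ?_
      rw [sum_const, hcount F hF]
      split_ifs <;> simp [mul_comm]
    · intro R F
      simp only [mem_filter, image_subset_iff]
      tauto
  rw [hR, ← sum_filter, ← sum_fiberwise_of_maps_to (t := range (j + 1)) (g := Finset.card)
    (fun F hF => by simpa [Nat.lt_succ_iff] using (mem_filter.1 hF).2), hNumber]
  refine sum_congr rfl fun n hn => ?_
  rw [filter_filter]
  have e : {F ∈ K.faces | #F ≤ j ∧ #F = n} = {F ∈ K.faces | #F = n} := by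
    refine filter_congr fun F _ => ?_
    simp only [mem_range] at hn
    omega
  rw [e, sum_congr rfl (g := fun _ => (-1 : ℤ) ^ (j - n) * ((d - n).choose (d - j) : ℤ))
    (fun F hF => by rw [(mem_filter.1 hF).2])]
  simp [numFaces, mul_comm]

end FinSimplicialComplex

/-! ### Stellar subdivision and colourings of the cells. -/

namespace CrossPolytopalComplex
open Finset FinSimplicialComplex

variable {V : Type*} [LinearOrder V] {d : ℕ} (X : CrossPolytopalComplex V d)

theorem cell_map_mem_skeleton (i : Fin X.numCells) {H : Finset (Fin d × Bool)}
    (hH : H ∈ (crossPolytope d).faces) : H.map (X.cell i) ∈ X.skeleton.faces :=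
  X.cell_boundary i (mem_image_of_mem _ hH)

/-- The face of the stellar subdivision spanned by a face of the boundary of a cell and the new
vertex of that cell. -/
def coneFace (x : Fin X.numCells × Finset (Fin d × Bool)) : Finset (V ⊕ₗ Fin X.numCells) :=
  insert (toLex (Sum.inr x.1)) ((x.2.map (X.cell x.1)).map (oldVertex V X.numCells))

theorem inr_notMem_map_oldVertex (i : Fin X.numCells) (F : Finset V) :
    toLex (Sum.inr i) ∉ F.map (oldVertex V X.numCells) := by
  simp [oldVertex]

/-- The bases of the cones already lie in the skeleton, so only the faces through an apex are new.
-/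
theorem stellar_faces_eq : X.stellar.faces =
    X.skeleton.faces.image (Finset.map (oldVertex V X.numCells)) ∪
      (univ ×ˢ (crossPolytope d).faces).image X.coneFace := by
  ext G
  simp only [stellar, FinSimplicialComplex.union, FinSimplicialComplex.iUnion, cone,
    FinSimplicialComplex.map, mem_union, mem_biUnion, mem_image, mem_univ, true_and, mem_product,
    Prod.exists, coneFace, ← Finset.map_map]
  constructor
  · rintro (h | ⟨i, ⟨H, hH, rfl⟩ | ⟨_, ⟨H, hH, rfl⟩, rfl⟩⟩)
    · exact Or.inl h
    · exact Or.inl ⟨_, X.cell_map_mem_skeleton i hH, rfl⟩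
    · exact Or.inr ⟨i, H, hH, rfl⟩
  · rintro (h | ⟨i, H, hH, rfl⟩)
    · exact Or.inl h
    · exact Or.inr ⟨i, Or.inr ⟨_, ⟨H, hH, rfl⟩, rfl⟩⟩

theorem coneFace_injective : Function.Injective X.coneFace := by
  rintro ⟨i, H⟩ ⟨i', H'⟩ h
  simp only [coneFace] at h
  have hi : i = i' := by
    have hmem : toLex (Sum.inr i) ∈ insert (toLex (Sum.inr i'))
        ((H'.map (X.cell i')).map (oldVertex V X.numCells)) := h ▸ mem_insert_self _ _
    simpa using (mem_insert.1 hmem).resolve_right (X.inr_notMem_map_oldVertex _ _)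
  subst hi
  have := congrArg (fun s => s.erase (toLex (Sum.inr i))) h
  simp only [erase_insert (X.inr_notMem_map_oldVertex _ _)] at this
  simpa using this

theorem map_oldVertex_mem_stellar_iff {F : Finset V} :
    F.map (oldVertex V X.numCells) ∈ X.stellar.faces ↔ F ∈ X.skeleton.faces := by
  rw [stellar_faces_eq, mem_union, mem_image, mem_image]
  constructor
  · rintro (⟨F', hF', h⟩ | ⟨x, _, h⟩)
    · rwa [← Finset.map_injective _ h]
    · exact absurd (h ▸ mem_insert_self _ _) (X.inr_notMem_map_oldVertex x.1 F)
  · exact fun h => Or.inl ⟨F, h, rfl⟩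

theorem empty_mem_skeleton : ∅ ∈ X.skeleton.faces := by
  simpa using X.cell_map_mem_skeleton ⟨0, X.numCells_pos⟩ (H := ∅) (by simp [crossPolytope])

/-- A proper colouring of the skeleton with `d` colours identifies the antipodal vertices of each
cell, and is a bijection between the diagonals of the cell and the colours. -/
theorem exists_colour_equiv (κ : V → Fin d)
    (hκ : ∀ F ∈ X.skeleton.faces, Set.InjOn κ (F : Set V)) (i : Fin X.numCells) :
    ∃ e : Fin d ≃ Fin d, ∀ x, κ (X.cell i x) = e x.1 := by
  have key : ∀ x y : Fin d × Bool, x.1 ≠ y.1 → κ (X.cell i x) ≠ κ (X.cell i y) := by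
    intro x y hxy h
    have hH : {x, y} ∈ (crossPolytope d).faces := by
      obtain ⟨x1, x2⟩ := x
      obtain ⟨y1, y2⟩ := y
      simp only [crossPolytope, mem_filter, mem_univ, true_and, mem_insert, mem_singleton,
        Prod.mk.injEq]
      grind
    have := hκ _ (X.cell_map_mem_skeleton i hH) (by simp) (by simp) h
    exact hxy (congrArg Prod.fst ((X.cell i).injective this))
  have hinj : Function.Injective fun a => κ (X.cell i (a, true)) := by
    intro a b h
    by_contra hab
    exact key (a, true) (b, true) hab h
  -- The ends `(a, true)` use all `d` colours, and `(a, b)` is adjacent to every `(c, true)` with `c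
  -- ≠ a`; only the colour of its own diagonal remains.
  refine ⟨Equiv.ofBijective _ (Finite.injective_iff_bijective.1 hinj), ?_⟩
  rintro ⟨a, b⟩
  obtain ⟨c, hc⟩ := (Finite.injective_iff_surjective.1 hinj) (κ (X.cell i (a, b)))
  by_cases hca : c = a
  · subst hca; exact hc.symm
  · exact absurd hc (key (c, true) (a, b) hca)

variable {k : Type*} [Field k] {Δ : FinSimplicialComplex V}

theorem IsHomologyBall.boundary_subset_skeleton {X : CrossPolytopalComplex V d}
    (hX : X.IsHomologyBall k Δ) : Δ.faces ⊆ X.skeleton.faces := by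
  intro F hF
  have hF' : F.map (oldVertex V X.numCells) ∈ (Δ.map (oldVertex V X.numCells)).faces :=
    mem_image_of_mem _ hF
  rcases (hX.isManifold.isBoundary _).1 hF' with h | h
  · rw [Finset.map_eq_empty.1 h]
    exact X.empty_mem_skeleton
  · exact X.map_oldVertex_mem_stellar_iff.1 h.1

/-- The empty face belongs to the boundary by convention; for it, global acyclicity replaces local
acyclicity. -/
theorem IsHomologyBall.sum_superfaces_eq_zero {X : CrossPolytopalComplex V d}
    (hX : X.IsHomologyBall k Δ) {F : Finset V} (hF : F ∈ Δ.faces) :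
    ∑ G ∈ X.stellar.faces with F.map (oldVertex V X.numCells) ⊆ G, (-1 : ℤ) ^ #G = 0 := by
  have hF' : F.map (oldVertex V X.numCells) ∈ (Δ.map (oldVertex V X.numCells)).faces :=
    mem_image_of_mem _ hF
  rcases (hX.isManifold.isBoundary _).1 hF' with h | h
  · rw [h]
    simpa using sum_faces_eq_zero_of_acyclic hX.acyclic
  · exact sum_superfaces_eq_zero_of_locallyAcyclic h.2

/-- The colours in `R` select `#R` diagonals of the cell, and the apex adds one vertex to every
face, hence the minus sign. -/
theorem sum_coneFaces (κ : V → Fin d) (hκ : ∀ F ∈ X.skeleton.faces, Set.InjOn κ (F : Set V))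
    (R : Finset (Fin d)) (i : Fin X.numCells) :
    ∑ H ∈ (crossPolytope d).faces with ∀ x ∈ H, κ (X.cell i x) ∈ R, (-1 : ℤ) ^ #(X.coneFace (i, H)) =
      -(-1) ^ #R := by
  obtain ⟨e, he⟩ := X.exists_colour_equiv κ hκ i
  have h := sum_crossPolytope_faces d (R.map e.symm.toEmbedding)
  rw [card_map] at h
  rw [← h, ← sum_neg_distrib]
  refine sum_congr (filter_congr fun H _ => ?_) fun H _ => ?_
  · simp only [he, mem_map_equiv, Equiv.symm_symm]
  · rw [coneFace, card_insert_of_notMem (X.inr_notMem_map_oldVertex _ _), card_map, card_map,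
      pow_succ, mul_neg_one]

/-- The flag `h`-numbers of the skeleton of a balanced ball, for the colour sets whose complement is
so small that all faces with colours in the complement lie in the boundary. -/
theorem IsHomologyBall.sum_skeleton_faces {X : CrossPolytopalComplex V d}
    (hX : X.IsHomologyBall k Δ) (κ : V → Fin d)
    (hκ : ∀ F ∈ X.skeleton.faces, Set.InjOn κ (F : Set V)) (R : Finset (Fin d))
    (hR : ∀ F ∈ X.skeleton.faces, (∀ v ∈ F, κ v ∉ R) → F ∈ Δ.faces) :
    ∑ F ∈ X.skeleton.faces with ∀ v ∈ F, κ v ∈ R, (-1 : ℤ) ^ #F = X.numCells * (-1) ^ #R := by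
  classical
  -- No apex satisfies `p`: a face inside `p` is an old face coloured outside `R`, while a face
  -- avoiding `p` may contain an apex.
  let p : V ⊕ₗ Fin X.numCells → Prop := fun x => ∃ v, oldVertex V X.numCells v = x ∧ κ v ∉ R
  have hp_inr : ∀ i, ¬ p (toLex (Sum.inr i)) := by
    rintro i ⟨v, hv, -⟩
    exact X.inr_notMem_map_oldVertex i {v} (by simp [hv])
  have hp_old : ∀ v, p (oldVertex V X.numCells v) ↔ κ v ∉ R := by
    intro v
    simp only [p, EmbeddingLike.apply_eq_iff_eq, exists_eq_left]
  have hzero := sum_faces_avoiding_eq_zero X.stellar p (by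
    intro F hF hFp
    rw [stellar_faces_eq, mem_union, mem_image, mem_image] at hF
    rcases hF with ⟨F', hF', rfl⟩ | ⟨x, _, rfl⟩
    · refine hX.sum_superfaces_eq_zero (hR F' hF' fun v hv => ?_)
      exact (hp_old v).1 (hFp _ (mem_map_of_mem _ hv))
    · exact absurd (hFp _ (mem_insert_self _ _)) (hp_inr _))
  rw [stellar_faces_eq, filter_union, sum_union, filter_image, filter_image,
    sum_image (Finset.map_injective _).injOn, sum_image X.coneFace_injective.injOn] at hzero
  · have h1 : ∑ F ∈ X.skeleton.faces with ∀ v ∈ F.map (oldVertex V X.numCells), ¬ p v,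
        (-1 : ℤ) ^ #(F.map (oldVertex V X.numCells)) =
        ∑ F ∈ X.skeleton.faces with ∀ v ∈ F, κ v ∈ R, (-1 : ℤ) ^ #F := by
      simp only [card_map, forall_mem_map, hp_old, not_not]
    have h2 : ∑ x ∈ univ ×ˢ (crossPolytope d).faces with ∀ v ∈ X.coneFace x, ¬ p v,
        (-1 : ℤ) ^ #(X.coneFace x) = -(X.numCells * (-1) ^ #R) := by
      rw [sum_filter, sum_product]
      simp only [← sum_filter]
      rw [sum_congr rfl (g := fun _ => -(-1 : ℤ) ^ #R)]
      · simp
      · intro i _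
        rw [← X.sum_coneFaces κ hκ R i]
        refine sum_congr (filter_congr fun H _ => ?_) fun _ _ => rfl
        simp only [coneFace, forall_mem_insert, hp_inr, forall_mem_map, hp_old, not_not,
          not_false_eq_true, true_and]
    rw [h1, h2] at hzero
    linarith
  · rw [disjoint_left]
    intro G hG hG'
    obtain ⟨F, _, rfl⟩ := mem_image.1 (mem_filter.1 hG).1
    obtain ⟨x, _, h⟩ := mem_image.1 (mem_filter.1 hG').1
    exact X.inr_notMem_map_oldVertex x.1 F (h ▸ mem_insert_self _ _)

end CrossPolytopalComplex

/-! ### The `h`-numbers in the middle range and the conclusion. -/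

namespace FinSimplicialComplex
open Finset

/-- The `h`-numbers in the middle range of a balanced sphere that bounds a stacked cross-polytopal
ball with `m` cells are those of `m` cross-polytopes. -/
theorem hNumber_eq_numCells_mul_choose {k : Type*} [Field k] {V : Type*} [LinearOrder V]
    {d r : ℕ} (hrd : r + 1 ≤ d) {Δ : FinSimplicialComplex V} (κ : V → Fin d)
    (hκ : ∀ F ∈ Δ.faces, Set.InjOn κ (F : Set V)) {X : CrossPolytopalComplex V d}
    (hX : X.IsHomologyBall k Δ)
    (hstacked : ∀ F ∈ X.skeleton.faces, #F + r ≤ d + 1 → F ∈ Δ.faces)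
    {j : ℕ} (hrj : r ≤ j + 1) (hjr : j + r ≤ d + 1) (hjd : j ≤ d) :
    Δ.hNumber d j = X.numCells * d.choose j := by
  -- Properness concerns only pairs of vertices, and these lie in `Δ` because `2 + r ≤ d + 1`.
  have hκX : ∀ F ∈ X.skeleton.faces, Set.InjOn κ (F : Set V) := by
    intro F hF v hv w hw h
    have hsub : {v, w} ⊆ F := by
      intro u hu
      rcases mem_insert.1 hu with rfl | hu
      · exact hv
      · rw [mem_singleton.1 hu]; exact hw
    have hcard : #{v, w} ≤ 2 := card_le_two
    exact hκ _ (hstacked _ (X.skeleton.down_closed F hF _ hsub) (by omega)) (by simp) (by simp) h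
  have hcard : ∀ F ∈ X.skeleton.faces, ∀ S : Finset (Fin d), (∀ v ∈ F, κ v ∈ S) → #F ≤ #S :=
    fun F hF S h => card_le_card_of_injOn κ h (hκX F hF)
  rw [hNumber_eq_sum_colours Δ hjd κ hκ, sum_congr rfl (g := fun _ => (X.numCells : ℤ))]
  · simp [mul_comm]
  intro R hR
  have hRj : #R = j := (mem_powersetCard.1 hR).2
  -- A face coloured outside `R` has at most `d - j` vertices, and `d - j + r ≤ d + 1` by `hrj`.
  have hsum := hX.sum_skeleton_faces κ hκX R fun F hF h => hstacked F hF (by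
    have := hcard F hF Rᶜ fun v hv => mem_compl.2 (h v hv)
    rw [card_compl, Fintype.card_fin, hRj] at this
    omega)
  have hfaces : {F ∈ X.skeleton.faces | ∀ v ∈ F, κ v ∈ R} = {F ∈ Δ.faces | ∀ v ∈ F, κ v ∈ R} := by
    ext F
    simp only [mem_filter]
    refine ⟨fun h => ⟨hstacked F h.1 ?_, h.2⟩, fun h => ⟨hX.boundary_subset_skeleton h.1, h.2⟩⟩
    have := hcard F h.1 R h.2
    omega
  rw [hfaces, hRj] at hsum
  calc ∑ F ∈ Δ.faces with ∀ v ∈ F, κ v ∈ R, (-1 : ℤ) ^ (j - #F)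
      = ∑ F ∈ Δ.faces with ∀ v ∈ F, κ v ∈ R, (-1 : ℤ) ^ j * (-1 : ℤ) ^ #F := by
        refine sum_congr rfl fun F hF => ?_
        -- This bound keeps the truncated exponent `j - #F` from changing the sign.
        have hle : #F ≤ j := hRj ▸ hcard F
          (hX.boundary_subset_skeleton (mem_filter.1 hF).1) R (mem_filter.1 hF).2
        obtain ⟨c, rfl⟩ := Nat.exists_eq_add_of_le hle
        rw [Nat.add_sub_cancel_left, pow_add, mul_right_comm, ← mul_pow]
        simp
    _ = X.numCells := by
        rw [← mul_sum, hsum, mul_left_comm, ← mul_pow]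
        simp

end FinSimplicialComplex

theorem theorem5p4 {k : Type*} [Field k] {V : Type*} [LinearOrder V] (d r : ℕ)
    (hr : 1 ≤ r) (hrd : r ≤ d) (Δ : FinSimplicialComplex V)
    (hbal : Δ.IsBalanced d) (hsphere : FinSimplicialComplex.IsHomologySphere k Δ d)
    (hstacked : FinSimplicialComplex.HasBalancedStackedProperty k Δ d r) :
    ∀ j, r ≤ j → j ≤ d / 2 → Δ.balancedG d j = 0 := by
  intro j hrj hjd
  obtain ⟨-, κ, hκ⟩ := hbal
  obtain ⟨X, hX, hXΔ⟩ := hstacked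
  obtain ⟨i, rfl⟩ : ∃ i, j = i + 1 := ⟨j - 1, by omega⟩
  -- The formula is used at `i + 1` and at `i`; the lower index needs only `r ≤ i + 1`. The bound `r
  -- + 1 ≤ d` follows from `1 ≤ r ≤ d / 2`.
  rw [FinSimplicialComplex.balancedG, Nat.add_sub_cancel,
    FinSimplicialComplex.hNumber_eq_numCells_mul_choose (by omega) κ hκ hX hXΔ
      (by omega) (by omega) (by omega),
    FinSimplicialComplex.hNumber_eq_numCells_mul_choose (by omega) κ hκ hX hXΔ
      (by omega) (by omega) (by omega)]
  have h := Nat.choose_succ_right_eq d i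
  zify [show i ≤ d by omega] at h
  push_cast
  linear_combination (X.numCells : ℤ) * h
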